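/- Let $(W,S)$ be a Coxeter system with $S=\{s_1,\dots,s_n\}$ finite and Coxeter matrix $(m_{ij})$, $m_{ij}\in\{2,3,\dots\}\cup\{\infty\}$ for $i\neq j$, and let $\Gamma$ be its Coxeter graph (vertex set $S$, with an edge $\{s_i,s_j\}$ whenever $m_{ij}\ge 3$). A Coxeter element is a product $s_{\pi(1)}s_{\pi(2)}\cdots s_{\pi(n)}$ of all the generators in some order $\pi$; let $C(W,S)$ be the set of Coxeter elements. Let $\mathsf{Acyc}(\Gamma)$ be the set of acyclic orientations of $\Gamma$; two of them are called $\kappa$-equivalent if one is obtained from the other by a finite sequence of clicks, where a click reverses all the edges at one source, turning it into a sink; let $\kappa(\Gamma)$ be the number of $\kappa$-equivalence classes. Directing each edge of $\Gamma$ from the generator that comes first in $\pi$ to the one that comes later gives a well-defined bijection $s_{\pi(1)}\cdots s_{\pi(n)}\mapsto O^\pi_\Gamma$ from $C(W,S)$ to $\mathsf{Acyc}(\Gamma)$, and $c\sim_\kappa c'$ for $c,c'\in C(W,S)$ means that the corresponding orientations are $\kappa$-equivalent. Then two Coxeter elements $c,c'\in C(W,S)$ are conjugate in $W$ if and only if $c\sim_\kappa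 c'$. Consequently, the number of conjugacy classes of $W$ that contain a Coxeter element is $\kappa(\Gamma)$. (This applies in particular to simply-laced systems, where all $m_{ij}\le 3$.) -/

import Mathlib

/-- An acyclic orientation of a simple graph: every edge gets a direction (`arc u v` means that the
edge `{u, v}` is directed from `u` to `v`), and there is no directed cycle. Acyclicity also excludes
that an edge is directed both ways, since that would be a directed cycle of length two. -/
@[ext]
structure AcyclicOrientation {V : Type*} (Γ : SimpleGraph V) where
  arc : V → V → Prop
  adj_iff : ∀ u v, Γ.Adj u v ↔ arc u v ∨ arc v u
  acyclic : ∀ v, ¬ Relation.TransGen arc v v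

namespace AcyclicOrientation

variable {V : Type*} {Γ : SimpleGraph V}

/-- The vertex `v` is a source: no arc ends in `v`. -/
def IsSource (O : AcyclicOrientation Γ) (v : V) : Prop := ∀ u, ¬ O.arc u v

/-- `O'` arises from `O` by a click (source-to-sink operation): some source `v` of `O` is turned
into a sink by reversing all arcs at `v`, and all other arcs are kept. -/
def Click (O O' : AcyclicOrientation Γ) : Prop :=
  ∃ v, O.IsSource v ∧
    ∀ u w, O'.arc u w ↔ ((u ≠ v ∧ w ≠ v) ∧ O.arc u w) ∨ ((u = v ∨ w = v) ∧ O.arc w u)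

/-- `κ`-equivalence: `O'` is obtained from `O` by a finite sequence of clicks. -/
def KappaEquiv : AcyclicOrientation Γ → AcyclicOrientation Γ → Prop :=
  Relation.ReflTransGen Click

/-- The acyclic orientation induced by a total order of the vertices, given as an enumeration
`π 0, π 1, …`: an edge is directed from the vertex that comes first to the one that comes later. -/
def ofOrder {n : ℕ} (Γ : SimpleGraph V) (π : Fin n ≃ V) : AcyclicOrientation Γ where
  arc u v := Γ.Adj u v ∧ π.symm u < π.symm v
  adj_iff u v := by
    constructor
    · intro h
      rcases lt_or_gt_of_ne (π.symm.injective.ne h.ne) with h' | h'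
      · exact Or.inl ⟨h, h'⟩
      · exact Or.inr ⟨h.symm, h'⟩
    · rintro (h | h)
      · exact h.1
      · exact h.1.symm
  acyclic v h := by
    have key : ∀ w, Relation.TransGen (fun a b => Γ.Adj a b ∧ π.symm a < π.symm b) v w →
        π.symm v < π.symm w := by
      intro w hw
      induction hw with
      | single h => exact h.2
      | tail _ h ih => exact ih.trans h.2
    exact lt_irrefl _ (key v h)

end AcyclicOrientation

/-- `κ(Γ)`: the number of `κ`-equivalence classes of acyclic orientations of `Γ`. -/
noncomputable def SimpleGraph.kappa {V : Type*} (Γ : SimpleGraph V) : ℕ :=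
  Nat.card (Quot (AcyclicOrientation.KappaEquiv (Γ := Γ)))

/-- The Coxeter graph (without edge weights): distinct vertices are adjacent iff `m(i,j) ≥ 3`,
where the value `0` of a Coxeter matrix stands for `∞`. -/
def CoxeterMatrix.coxeterGraph {B : Type*} (M : CoxeterMatrix B) : SimpleGraph B where
  Adj i j := i ≠ j ∧ M i j ≠ 2
  symm := ⟨fun i j h => ⟨h.1.symm, by rw [M.symmetric j i]; exact h.2⟩⟩
  loopless := ⟨fun _ h => h.1 rfl⟩

namespace CoxeterSystem

variable {B W : Type*} [Group W] {M : CoxeterMatrix B} (cs : CoxeterSystem M W)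

/-- The product of all the generators, each taken once, in the order `π`. -/
def orderedProd {n : ℕ} (π : Fin n ≃ B) : W := cs.wordProd (List.ofFn π)

/-- The set `C(W,S)` of Coxeter elements: the products of all the generators in some order. -/
def coxeterElements : Set W := Set.range fun π : Fin (Nat.card B) ≃ B => cs.orderedProd π

end CoxeterSystem

/-! A click moves the first letter of a suitable word to its end, which is conjugation by a
generator (`isConj_of_click`). For the converse, weights with w_ij w_ji = 1 deform the geometric
representation without breaking the Coxeter relations. If U is the unipotent upper part of the
deformed Cartan matrix A in the order of the Coxeter element c, then U(1 - c) = A. So det(T - c) =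
det(TU + A - U) (`det_smul_sub_toHom`), and conjugate Coxeter elements share this value for all T
and all weights. Let τ be a permutation that moves points along edges and has no 2-cycles, and take
as weights large powers of T favouring the arcs i → τ i. As T → ∞, the term of τ alone dominates the
Leibniz expansion; up to a constant independent of the order, its exponent counts the forward arcs
of τ. This count is therefore a conjugacy invariant (`sum_perm_eq_of_isConj`). Orientations with
equal counts on all cycles differ by a coboundary (`exists_coboundary_of_sum_perm_eq_zero`), whose
potential, shifted to be nonnegative, says how often to click each vertex
(`kappaEquiv_of_coboundary`). That a Coxeter element determines its orientation is also read off
from a representation (`lt_of_wordProd_eq`). -/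

/-! ### Reflection representations with prescribed pairings -/

open Module in
theorem Module.reflection_mul_reflection_pow_eq_one {V : Type*} [AddCommGroup V] [Module ℝ V]
    {x y : V} {f g : Dual ℝ V} (hf : f x = 2) (hg : g y = 2) {m : ℕ} (hm : 3 ≤ m)
    (h : f y * g x = 4 * Real.cos (Real.pi / m) ^ 2) :
    (reflection hf * reflection hg) ^ m = 1 := by
  set θ : ℝ := Real.pi / m with hθ
  have hm0 : (m : ℝ) ≠ 0 := by positivity
  have hmθ : m * θ = Real.pi := by rw [hθ]; field_simp
  have ht : f y * g x - 2 = 2 * Real.cos (2 * θ) := by rw [h, Real.cos_two_mul]; ring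
  -- Since S_n(2 cos φ) sin φ = sin((n+1)φ), zeros of S can be read off from sines only if sin φ ≠
  -- 0, here with φ = 2θ; this is where m ≥ 3 enters.
  have hsin : Real.sin (2 * θ) ≠ 0 := by
    have h3 : (3 : ℝ) ≤ m := by exact_mod_cast hm
    have hpos : 0 < θ := by positivity
    apply (Real.sin_pos_of_pos_of_lt_pi (by positivity) _).ne'
    nlinarith [Real.pi_pos]
  have hS (n : ℤ) := Polynomial.Chebyshev.S_two_mul_real_cos (2 * θ) n
  ext z
  rw [reflection_mul_reflection_pow_apply hf hg m z, ht]
  obtain ⟨k, rfl | rfl⟩ := m.even_or_odd'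
  · have h0 : (Polynomial.Chebyshev.S ℝ ((k : ℤ) - 1)).eval (2 * Real.cos (2 * θ)) = 0 := by
      have := hS (k - 1)
      have e : (((k : ℤ) - 1 : ℤ) + 1 : ℝ) * (2 * θ) = Real.pi := by
        rw [← hmθ]; push_cast; ring
      rw [e, Real.sin_pi] at this
      exact (mul_eq_zero.1 this).resolve_right hsin
    rw [show ((2 * k : ℕ) - 2 : ℤ) / 2 = k - 1 by omega,
      show ((2 * k : ℕ) - 1 : ℤ) / 2 = k - 1 by omega, h0]
    simp
  · have h0 : (Polynomial.Chebyshev.S ℝ (k : ℤ)).eval (2 * Real.cos (2 * θ)) +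
        (Polynomial.Chebyshev.S ℝ ((k : ℤ) - 1)).eval (2 * Real.cos (2 * θ)) = 0 := by
      have e1 := hS k
      have e2 := hS (k - 1)
      have e : Real.sin (((k : ℤ) + 1 : ℝ) * (2 * θ)) +
          Real.sin ((((k : ℤ) - 1 : ℤ) + 1 : ℝ) * (2 * θ)) = 0 := by
        have a1 : ((k : ℤ) + 1 : ℝ) * (2 * θ) = Real.pi + θ := by rw [← hmθ]; push_cast; ring
        have a2 : (((k : ℤ) - 1 : ℤ) + 1 : ℝ) * (2 * θ) = Real.pi - θ := by
          rw [← hmθ]; push_cast; ring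
        rw [a1, a2, Real.sin_pi_sub, add_comm Real.pi, Real.sin_add_pi]; ring
      rw [← e1, ← e2, ← add_mul] at e
      exact (mul_eq_zero.1 e).resolve_right hsin
    rw [show ((2 * k + 1 : ℕ) - 2 : ℤ) / 2 = k - 1 by omega,
      show ((2 * k + 1 : ℕ) - 1 : ℤ) / 2 = k by omega,
      show ((2 * k + 1 : ℕ) - 3 : ℤ) / 2 = k - 1 by omega,
      show ((2 * k + 1 : ℕ) : ℤ) / 2 = k by omega, h0]
    simp

/-- Vectors and linear forms whose reflections satisfy the Coxeter relations of `M`. -/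
structure CoxeterMatrix.IsRealization {B V : Type*} [AddCommGroup V] [Module ℝ V]
    (M : CoxeterMatrix B) (α : B → V) (f : B → Module.Dual ℝ V) : Prop where
  two : ∀ i, f i (α i) = 2
  eq_zero : ∀ i j, M i j = 2 → f i (α j) = 0
  mul_eq : ∀ i j, 3 ≤ M i j → f i (α j) * f j (α i) = 4 * Real.cos (Real.pi / M i j) ^ 2

namespace CoxeterMatrix.IsRealization

variable {B V W : Type*} [AddCommGroup V] [Module ℝ V] [Group W] {M : CoxeterMatrix B}
  {α : B → V} {f : B → Module.Dual ℝ V}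

theorem isLiftable (h : M.IsRealization α f) :
    M.IsLiftable fun i => Module.reflection (h.two i) := by
  intro i j
  obtain rfl | hij := eq_or_ne i j
  · rw [M.diagonal, pow_one]
    ext z
    exact Module.involutive_reflection (h.two i) z
  have h1 := M.off_diagonal i j hij
  obtain h0 | h2 | h3 : M i j = 0 ∨ M i j = 2 ∨ 3 ≤ M i j := by
    change M i j ≠ 1 at h1
    omega
  · rw [h0, pow_zero]
  · rw [h2]
    ext z
    have e1 := h.eq_zero i j h2
    have e2 := h.eq_zero j i (by rwa [M.symmetric])
    simp only [pow_two, LinearEquiv.mul_apply, Module.reflection_apply, map_sub, map_smul, e1, e2,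
      h.two, LinearEquiv.coe_one, id_eq]
    module
  · exact Module.reflection_mul_reflection_pow_eq_one _ _ h3 (h.mul_eq i j h3)

/-- The reflection representation attached to a realization. -/
noncomputable def toHom (h : M.IsRealization α f) (cs : CoxeterSystem M W) : W →* (V ≃ₗ[ℝ] V) :=
  cs.lift ⟨_, h.isLiftable⟩

theorem toHom_simple (h : M.IsRealization α f) (cs : CoxeterSystem M W) (i : B) (x : V) :
    h.toHom cs (cs.simple i) x = x - f i x • α i := by
  rw [toHom, cs.lift_apply_simple, Module.reflection_apply]

/-- Peel off the leftmost letter, which acts last: its coefficient is its form evaluated at x minus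
the contributions of the letters after it. The coefficients thus solve a unipotent triangular
system. -/
theorem exists_toHom_wordProd [Fintype B] {P : Type*} [LinearOrder P]
    (h : M.IsRealization α f) (cs : CoxeterSystem M W) (key : B → P) (l : List B)
    (hl : l.Pairwise fun i j => key i < key j) (x : V) :
    ∃ u : B → ℝ, (∀ i, i ∉ l → u i = 0) ∧ h.toHom cs (cs.wordProd l) x = x - ∑ i, u i • α i ∧
      ∀ i ∈ l, u i + ∑ j, (if key i < key j then f i (α j) else 0) * u j = f i x := by
  classical
  induction l with
  | nil => exact ⟨0, by simp⟩
  | cons i l ih =>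
    rw [List.pairwise_cons] at hl
    obtain ⟨u, hu0, hux, hu⟩ := ih hl.2
    have hil : i ∉ l := fun hi => lt_irrefl _ (hl.1 i hi)
    have hui : u i = 0 := hu0 i hil
    set y := h.toHom cs (cs.wordProd l) x with hy
    have hupd (g : B → ℝ) (hg : g i = 0) :
        ∑ j, g j * Function.update u i (f i y) j = ∑ j, g j * u j := by
      refine Finset.sum_congr rfl fun j _ => ?_
      obtain rfl | hj := eq_or_ne j i
      · simp [hg]
      · rw [Function.update_of_ne hj]
    refine ⟨Function.update u i (f i y), fun j hj => ?_, ?_, fun j hj => ?_⟩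
    · rw [List.mem_cons, not_or] at hj
      rw [Function.update_of_ne hj.1, hu0 j hj.2]
    · rw [cs.wordProd_cons, map_mul, LinearEquiv.mul_apply, ← hy, h.toHom_simple]
      have : ∑ j, Function.update u i (f i y) j • α j = ∑ j, u j • α j + f i y • α i := by
        rw [← Finset.add_sum_erase _ _ (Finset.mem_univ i),
          ← Finset.add_sum_erase _ (fun j => u j • α j) (Finset.mem_univ i), hui,
          Function.update_self, zero_smul, zero_add, add_comm]
        congr 1
        refine Finset.sum_congr rfl fun j hj => ?_
        rw [Function.update_of_ne (Finset.ne_of_mem_erase hj)]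
      rw [this, hux]
      abel
    · rw [List.mem_cons] at hj
      rcases hj with rfl | hj
      · rw [hupd _ (by simp), Function.update_self, hux, map_sub, map_sum, sub_add_eq_add_sub,
          sub_eq_iff_eq_add]
        congr 1
        refine Finset.sum_congr rfl fun k _ => ?_
        by_cases hk : k ∈ l
        · rw [if_pos (hl.1 k hk), map_smul, smul_eq_mul, mul_comm]
        · simp [hu0 k hk]
      · have hne : j ≠ i := fun e => hil (e ▸ hj)
        rw [hupd _ (by simp [(hl.1 j hj).le]), Function.update_of_ne hne]
        exact hu j hj

end CoxeterMatrix.IsRealization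

/-! ### Deformed Cartan matrices and characteristic polynomials -/

theorem CoxeterMatrix.cos_pi_div_pos {B : Type*} (M : CoxeterMatrix B) {i j : B} (h : M.coxeterGraph.Adj i j) :
    0 < Real.cos (Real.pi / M i j) := by
  have h1 := M.off_diagonal i j h.1
  have h2 := h.2
  obtain h0 | h3 : M i j = 0 ∨ 3 ≤ M i j := by
    change M i j ≠ 1 at h1
    omega
  -- Here `0` encodes ∞, and division by zero gives cos 0 = 1, the usual value for an infinite
  -- label.
  · simp [h0]
  · have h3 : (3 : ℝ) ≤ M i j := by exact_mod_cast h3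
    refine Real.cos_pos_of_mem_Ioo ⟨?_, ?_⟩
    · have : 0 < Real.pi / M i j := by positivity
      linarith [Real.pi_pos]
    · rw [div_lt_div_iff₀ (by positivity) (by positivity)]
      nlinarith [Real.pi_pos]

/-- The Cartan matrix of the geometric representation, deformed by the weights `w`. -/
noncomputable def CoxeterMatrix.cartan {B : Type*} [DecidableEq B] (M : CoxeterMatrix B)
    (w : B → B → ℝ) : Matrix B B ℝ :=
  .of fun i j => if i = j then 2 else if M i j = 2 then 0 else
    -(2 * Real.cos (Real.pi / M i j)) * w i j

namespace CoxeterMatrix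

variable {B V : Type*} [AddCommGroup V] [Module ℝ V] [DecidableEq B] {M : CoxeterMatrix B}

theorem cartan_of_adj {i j : B} (h : M.coxeterGraph.Adj i j) (w : B → B → ℝ) :
    M.cartan w i j = -(2 * Real.cos (Real.pi / M i j)) * w i j := by
  simp [cartan, h.1, h.2]

theorem cartan_of_not_adj {i j : B} (h : i ≠ j) (h' : ¬ M.coxeterGraph.Adj i j)
    (w : B → B → ℝ) : M.cartan w i j = 0 := by
  have : M i j = 2 := by by_contra h2; exact h' ⟨h, h2⟩
  simp [cartan, h, this]

/-- The relations see only the products A_ij A_ji, in which the weights cancel. -/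
theorem isRealization_of_cartan {w : B → B → ℝ} (hw : ∀ i j, i ≠ j → w i j * w j i = 1)
    {α : B → V} {f : B → Module.Dual ℝ V} (h : ∀ i j, f i (α j) = M.cartan w i j) :
    M.IsRealization α f where
  two i := by simp [h, cartan]
  eq_zero i j h2 := by
    have : i ≠ j := by rintro rfl; simp at h2
    simp [h, cartan, this, h2]
  mul_eq i j h3 := by
    have hij : i ≠ j := by rintro rfl; simp at h3
    have ha : M.coxeterGraph.Adj i j := ⟨hij, by omega⟩
    rw [h, h, cartan_of_adj ha, cartan_of_adj ha.symm, M.symmetric j i]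
    linear_combination (4 * Real.cos (Real.pi / M i j) ^ 2) * hw i j hij

end CoxeterMatrix

theorem Matrix.det_one_add_upper {B P : Type*} [Fintype B] [DecidableEq B] [LinearOrder P]
    (A : Matrix B B ℝ) {key : B → P} (hinj : key.Injective) :
    (1 + Matrix.of fun i j => if key i < key j then A i j else 0).det = 1 := by
  let _ : LinearOrder B := LinearOrder.lift' key hinj
  have ht : (1 + Matrix.of fun i j => if key i < key j then A i j else 0).BlockTriangular id := by
    intro i j hij
    have hij : key j < key i := hij
    have hne : i ≠ j := by rintro rfl; exact lt_irrefl _ hij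
    simp [hne, hij.not_gt]
  rw [Matrix.det_of_isUpperTriangular ht]
  simp

namespace CoxeterMatrix

variable {B W : Type*} [Fintype B] [DecidableEq B] [Group W] {M : CoxeterMatrix B}

theorem isRealization_single {w : B → B → ℝ} (hw : ∀ i j, i ≠ j → w i j * w j i = 1) :
    M.IsRealization (fun i => (Pi.single i 1 : B → ℝ))
      (fun i => LinearMap.proj i ∘ₗ (M.cartan w).mulVecLin) :=
  isRealization_of_cartan hw fun i j => by simp

/-- The matrix `T • U + L`, where `U` and `L` are the unipotent upper and lower parts of the Cartan
matrix `A` for the order `key`. It equals `U * (T - c)` for the Coxeter element `c` of that order. -/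
def coxeterPencil {P : Type*} [LinearOrder P] (A : Matrix B B ℝ) (key : B → P) (T : ℝ) :
    Matrix B B ℝ :=
  .of fun i j => if i = j then T + 1 else (if key i < key j then T else 1) * A i j

/-- Multiplying by the unipotent U does not change the determinant, and the triangular system of
`exists_toHom_wordProd` says U(1 - c) = A, hence U(T - c) = TU + (A - U). -/
theorem det_smul_sub_toHom {P : Type*} [LinearOrder P] {w : B → B → ℝ}
    (hw : ∀ i j, i ≠ j → w i j * w j i = 1) (cs : CoxeterSystem M W) {key : B → P}
    (hinj : key.Injective) {l : List B} (hl : l.Pairwise fun i j => key i < key j)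
    (hmem : ∀ i, i ∈ l) (T : ℝ) :
    LinearMap.det (T • LinearMap.id -
      ((isRealization_single hw).toHom cs (cs.wordProd l) : (B → ℝ) →ₗ[ℝ] B → ℝ)) =
      (coxeterPencil (M.cartan w) key T).det := by
  set A := M.cartan w with hA
  set ρ := ((isRealization_single hw).toHom cs (cs.wordProd l) : (B → ℝ) →ₗ[ℝ] B → ℝ) with hρ
  let N : Matrix B B ℝ := .of fun i j => if key i < key j then A i j else 0
  have hU : (1 + N).det = 1 := Matrix.det_one_add_upper A hinj
  rw [← LinearMap.det_toMatrix', ← one_mul (Matrix.det _), ← hU, ← Matrix.det_mul]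
  congr 1
  have key_eq (x : B → ℝ) : (1 + N).mulVec (ρ x) = (1 + N).mulVec x - A.mulVec x := by
    obtain ⟨u, -, hu, huN⟩ :=
      (isRealization_single hw).exists_toHom_wordProd cs key l hl x
    have hx : ρ x = x - u := by
      refine hu.trans ?_
      congr 1
      ext i
      simp [Finset.sum_apply, Pi.single_apply]
    rw [hx, Matrix.mulVec_sub]
    congr 1
    ext i
    have := huN i (hmem i)
    rw [Matrix.add_mulVec, Matrix.one_mulVec]
    refine Eq.trans ?_ this
    simp [N, Matrix.mulVec, dotProduct, hA, Pi.single_apply]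
  apply Matrix.toLin'.injective
  ext1 j
  ext i
  have hk := congrFun (key_eq (Pi.single j 1)) i
  have e1 : ((1 + N) * LinearMap.toMatrix' (T • LinearMap.id - ρ)).mulVec (Pi.single j 1) i =
      T * (1 + N) i j - (1 + N).mulVec (ρ (Pi.single j 1)) i := by
    rw [← Matrix.mulVec_mulVec, ← Matrix.toLin'_apply (LinearMap.toMatrix' _),
      Matrix.toLin'_toMatrix']
    simp [Matrix.mulVec_sub, Matrix.mulVec_smul]
  simp only [LinearMap.comp_apply, LinearMap.single_apply, Matrix.toLin'_apply]
  rw [e1, hk]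
  by_cases hij : i = j
  · subst hij
    simp [N, coxeterPencil, hA, cartan]
    ring
  · by_cases hlt : key i < key j <;> simp [N, coxeterPencil, hij, hlt, hA]

theorem det_coxeterPencil_eq_of_isConj {P : Type*} [LinearOrder P] {w : B → B → ℝ}
    (hw : ∀ i j, i ≠ j → w i j * w j i = 1) (cs : CoxeterSystem M W) {key key' : B → P}
    (hinj : key.Injective) (hinj' : key'.Injective) {l l' : List B} (hl : l.Pairwise fun i j => key i < key j)
    (hl' : l'.Pairwise fun i j => key' i < key' j) (hmem : ∀ i, i ∈ l) (hmem' : ∀ i, i ∈ l')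
    (hconj : IsConj (cs.wordProd l) (cs.wordProd l')) (T : ℝ) :
    (coxeterPencil (M.cartan w) key T).det = (coxeterPencil (M.cartan w) key' T).det := by
  rw [← det_smul_sub_toHom hw cs hinj hl hmem, ← det_smul_sub_toHom hw cs hinj' hl' hmem']
  obtain ⟨g, hg⟩ := isConj_iff.1 hconj
  rw [← hg]
  set ρ := (isRealization_single hw).toHom cs
  rw [← LinearMap.det_conj _ (ρ g)]
  congr 1
  ext1 j
  ext i
  have hsymm : (ρ g).symm = ρ g⁻¹ := by rw [map_inv]; rfl
  simp [hsymm]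

end CoxeterMatrix

/-! ### Asymptotics of the deformed determinant -/

-- In the Leibniz expansion every term other than that of τ vanishes identically or has smaller
-- order of growth.
open Filter Topology in
theorem Matrix.tendsto_det_mul_zpow {B : Type*} [Fintype B] [DecidableEq B]
    {A : ℝ → Matrix B B ℝ} {c : Matrix B B ℝ} {e : B → B → ℤ}
    (hA : ∀ i j, Tendsto (fun T => A T i j * T ^ (-e i j)) atTop (𝓝 (c i j)))
    (τ : Equiv.Perm B)
    (h : ∀ σ : Equiv.Perm B, σ ≠ τ → (∃ i, ∀ T, A T i (σ i) = 0) ∨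
      ∑ i, e i (σ i) < ∑ i, e i (τ i)) :
    Tendsto (fun T => (A T).det * T ^ (-∑ i, e i (τ i))) atTop
      (𝓝 (Equiv.Perm.sign τ * ∏ i, c i (τ i))) := by
  have hdet (T : ℝ) : (A T).det = ∑ σ : Equiv.Perm B, (Equiv.Perm.sign σ : ℝ) *
      ∏ i, A T i (σ i) := by
    rw [← Matrix.det_transpose, Matrix.det_apply']
    rfl
  have hlim : (Equiv.Perm.sign τ * ∏ i, c i (τ i) : ℝ) =
      ∑ σ : Equiv.Perm B, if σ = τ then (Equiv.Perm.sign τ * ∏ i, c i (τ i) : ℝ) else 0 := by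
    simp
  simp only [hdet, Finset.sum_mul]
  rw [hlim]
  refine tendsto_finsetSum _ fun σ _ => ?_
  have hprod := tendsto_finsetProd Finset.univ fun i _ => hA i (σ i)
  have hsplit (T : ℝ) (hT : T ≠ 0) : (Equiv.Perm.sign σ : ℝ) * (∏ i, A T i (σ i)) *
      T ^ (-∑ i, e i (τ i)) = (Equiv.Perm.sign σ * ∏ i, A T i (σ i) * T ^ (-e i (σ i))) *
        T ^ (∑ i, e i (σ i) - ∑ i, e i (τ i)) := by
    have hz : ∏ i, T ^ (-e i (σ i)) = T ^ (-∑ i, e i (σ i)) := by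
      rw [← Finset.sum_neg_distrib]
      induction (Finset.univ : Finset B) using Finset.induction_on with
      | empty => simp
      | insert a s ha ih => rw [Finset.prod_insert ha, Finset.sum_insert ha, zpow_add₀ hT, ih]
    rw [Finset.prod_mul_distrib, hz, mul_assoc, mul_assoc, mul_assoc, ← zpow_add₀ hT]
    ring_nf
  split_ifs with hσ
  · subst hσ
    refine (hprod.const_mul (Equiv.Perm.sign σ : ℝ)).congr' ?_
    filter_upwards [eventually_ne_atTop 0] with T hT
    rw [hsplit T hT, sub_self, zpow_zero, mul_one]
  · rcases h σ hσ with ⟨i, hi⟩ | hlt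
    · refine tendsto_const_nhds.congr fun T => ?_
      rw [Finset.prod_eq_zero (Finset.mem_univ i) (hi T)]
      simp
    · have hzero : Tendsto (fun T : ℝ => T ^ (∑ i, e i (σ i) - ∑ i, e i (τ i))) atTop (𝓝 0) :=
        tendsto_zpow_atTop_zero (by omega)
      have := (hprod.const_mul (Equiv.Perm.sign σ : ℝ)).mul hzero
      rw [mul_zero] at this
      refine this.congr' ?_
      filter_upwards [eventually_ne_atTop 0] with T hT
      rw [hsplit T hT]

-- Applied in both directions, this makes the growth exponent of a function unique.
open Filter Topology in
theorem le_of_tendsto_mul_zpow {D : ℝ → ℝ} {E E' : ℤ} {a a' : ℝ} (ha' : a' ≠ 0)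
    (h : Tendsto (fun T => D T * T ^ (-E)) atTop (𝓝 a))
    (h' : Tendsto (fun T => D T * T ^ (-E')) atTop (𝓝 a')) : E' ≤ E := by
  by_contra hlt
  have hz : Tendsto (fun T : ℝ => T ^ (E - E')) atTop (𝓝 0) :=
    tendsto_zpow_atTop_zero (by omega)
  have h0 := h.mul hz
  rw [mul_zero] at h0
  refine ha' (tendsto_nhds_unique (h'.congr' ?_) h0)
  filter_upwards [eventually_ne_atTop 0] with T hT
  rw [mul_assoc, ← zpow_add₀ hT]
  ring_nf

namespace CoxeterMatrix

variable {B W : Type*} [Fintype B] [DecidableEq B] [Group W] {M : CoxeterMatrix B}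

/-- The indicator function of the arcs `i → τ i`, antisymmetrized. -/
def permFlow (τ : Equiv.Perm B) (i j : B) : ℤ :=
  (if τ i = j then 1 else 0) - if τ j = i then 1 else 0

open Classical in
/-- Among the permutations along edges of the graph, `τ` is the only one that maximizes the
exponent. -/
theorem sum_exponent_lt {n : ℕ} {key : B → Fin n} (hinj : key.Injective) {τ σ : Equiv.Perm B}
    (hτ : ∀ i, τ i ≠ i → τ (τ i) ≠ i) (hσ : σ ≠ τ) :
    ∑ i, ((if key i ≤ key (σ i) then 1 else 0) + (Fintype.card B + 1) * permFlow τ i (σ i)) <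
    ∑ i, ((if key i ≤ key (τ i) then 1 else 0) +
      (Fintype.card B + 1) * permFlow τ i (τ i)) := by
  have hself (i : B) : permFlow τ i (τ i) = if τ i = i then 0 else 1 := by
    by_cases h : τ i = i
    · simp [permFlow, h]
    · simp [permFlow, h, hτ i h]
  have hle (i : B) : permFlow τ i (σ i) ≤ permFlow τ i (τ i) := by
    rw [hself]
    by_cases h : τ i = i
    · have : τ (σ i) = i ↔ i = σ i := by
        rw [← τ.injective.eq_iff (a := i) (b := σ i), h, eq_comm]
      simp [permFlow, h, this]
    · rw [if_neg h, permFlow]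
      split_ifs <;> simp
  have hk1 (ρ : Equiv.Perm B) : ∑ i, (if key i ≤ key (ρ i) then 1 else 0 : ℤ) ≤
      Fintype.card B := by
    calc _ ≤ ∑ i : B, (1 : ℤ) := Finset.sum_le_sum fun i _ => by split_ifs <;> simp
      _ = _ := by simp
  have hk0 (ρ : Equiv.Perm B) : 0 ≤ ∑ i, (if key i ≤ key (ρ i) then 1 else 0 : ℤ) :=
    Finset.sum_nonneg fun i _ => by split_ifs <;> simp
  rw [Finset.sum_add_distrib, Finset.sum_add_distrib, ← Finset.mul_sum, ← Finset.mul_sum]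
  -- The order part of the exponent lies between 0 and `Fintype.card B`, so any loss in the flow
  -- part, weighted by one more than that, is decisive. In a tie, σ agrees with τ off the fixed
  -- points of τ.
  by_cases heq : ∀ i, permFlow τ i (σ i) = permFlow τ i (τ i)
  · rw [Finset.sum_congr rfl fun i _ => heq i]
    gcongr ?_ + _
    have hagree (i : B) (h : τ i ≠ i) : σ i = τ i := by
      have := heq i
      rw [hself, if_neg h, permFlow] at this
      by_contra hne
      rw [if_neg (Ne.symm hne)] at this
      split_ifs at this <;> omega
    refine Finset.sum_lt_sum (fun i _ => ?_) ?_
    · by_cases h : τ i = i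
      · simp only [h, le_refl, if_true]
        split_ifs <;> simp
      · rw [hagree i h]
    · obtain ⟨i₀, hi₀⟩ : ∃ i, σ i ≠ τ i := by
        by_contra hcon
        push Not at hcon
        exact hσ (Equiv.ext hcon)
      have hfix₀ : τ i₀ = i₀ := by
        by_contra h
        exact hi₀ (hagree _ h)
      -- Among the fixed points of τ moved by σ take the one with the largest key. Its image under σ
      -- is again such a point, so σ moves it down and loses a unit there.
      obtain ⟨i, hi, hmax⟩ := Finset.exists_max_image
        (Finset.univ.filter fun i => τ i = i ∧ σ i ≠ i) key
        ⟨i₀, by simp [hfix₀]; rwa [hfix₀] at hi₀⟩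
      obtain ⟨hi1, hi2⟩ : τ i = i ∧ σ i ≠ i := by simpa using hi
      have hσi : τ (σ i) = σ i := by
        by_contra h
        have h1 : τ (τ.symm (σ i)) ≠ τ.symm (σ i) := by
          intro e
          rw [Equiv.apply_symm_apply] at e
          apply h
          nth_rw 1 [e]
          simp
        have h2 := hagree _ h1
        rw [Equiv.apply_symm_apply] at h2
        have h3 : τ.symm (σ i) = i := σ.injective h2
        rw [Equiv.symm_apply_eq, hi1] at h3
        exact hi2 h3
      have hlt := hmax (σ i) (by simpa [hσi] using hi2)
      refine ⟨i, Finset.mem_univ i, ?_⟩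
      have : ¬ key i ≤ key (σ i) := fun h => hi2 (hinj (le_antisymm hlt h))
      simp [this, hi1]
  · push Not at heq
    obtain ⟨i, hi⟩ := heq
    have hlt : ∑ i, permFlow τ i (σ i) < ∑ i, permFlow τ i (τ i) :=
      Finset.sum_lt_sum (fun i _ => hle i) ⟨i, Finset.mem_univ i, (hle i).lt_of_ne hi⟩
    have h1 := hk1 σ
    have h0 := hk0 τ
    nlinarith

-- The leading coefficient is a signed product of ones and of factors -2 cos(π/m) along edges, hence
-- nonzero.
open Filter Topology in
theorem exists_tendsto_det_coxeterPencil {n : ℕ} {key : B → Fin n} (hinj : key.Injective)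
    {τ : Equiv.Perm B} (hτ : ∀ i, τ i ≠ i → M.coxeterGraph.Adj i (τ i) ∧ τ (τ i) ≠ i) :
    ∃ a : ℝ, a ≠ 0 ∧ Tendsto (fun T : ℝ => (coxeterPencil
      (M.cartan fun i j => T ^ ((Fintype.card B + 1) * permFlow τ i j)) key T).det *
      T ^ (-∑ i, ((if key i ≤ key (τ i) then 1 else 0) +
        (Fintype.card B + 1) * permFlow τ i (τ i)))) atTop (𝓝 a) := by
  classical
  -- Leading coefficients of the entries. A diagonal entry T + 1 has exponent 1 and coefficient 1,
  -- which is why the exponent uses `≤` on keys and why 1 is subtracted from the diagonal 2.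
  let c : Matrix B B ℝ := .of fun i j => M.cartan (fun _ _ => 1) i j - if i = j then 1 else 0
  refine ⟨_, ?_, Matrix.tendsto_det_mul_zpow (c := c)
    (e := fun i j => (if key i ≤ key j then 1 else 0) +
      (Fintype.card B + 1) * permFlow τ i j) (fun i j => ?_) τ fun σ hσ => ?_⟩
  · refine mul_ne_zero (by simp) (Finset.prod_ne_zero_iff.2 fun i _ => ?_)
    by_cases h : τ i = i
    · simp [c, h, cartan]
      norm_num
    · have ha := (hτ i h).1
      simp [c, Ne.symm h, cartan_of_adj ha, (M.cos_pi_div_pos ha).ne']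
  · by_cases hij : i = j
    · subst hij
      have : Tendsto (fun T : ℝ => 1 + T⁻¹) atTop (𝓝 (1 + 0)) :=
        tendsto_inv_atTop_zero.const_add 1
      have hc : c i i = 1 + 0 := by simp [c, cartan]; norm_num
      rw [hc]
      refine this.congr' ?_
      filter_upwards [eventually_ne_atTop 0] with T hT
      simp [coxeterPencil, permFlow]
      field_simp
    · refine tendsto_const_nhds.congr' ?_
      filter_upwards [eventually_ne_atTop 0] with T hT
      have hkey : key i ≤ key j ↔ key i < key j :=
        ⟨fun h => h.lt_of_ne (hinj.ne hij), le_of_lt⟩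
      by_cases ha : M.coxeterGraph.Adj i j
      · simp only [c, coxeterPencil, Matrix.of_apply, if_neg hij, cartan_of_adj ha, hkey]
        rw [neg_add, zpow_add₀ hT, zpow_neg T ((Fintype.card B + 1) * permFlow τ i j)]
        have := zpow_ne_zero ((Fintype.card B + 1) * permFlow τ i j) hT
        split_ifs
        · simp; field_simp
        · simp; field_simp
      · simp [c, coxeterPencil, hij, cartan_of_not_adj hij ha]
  · by_cases h : ∃ i, σ i ≠ i ∧ ¬ M.coxeterGraph.Adj i (σ i)
    · obtain ⟨i, hi, ha⟩ := h
      refine Or.inl ⟨i, fun T => ?_⟩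
      simp [coxeterPencil, Ne.symm hi, cartan_of_not_adj (Ne.symm hi) ha]
    · exact Or.inr (sum_exponent_lt hinj (fun i hi => (hτ i hi).2) hσ)

/-- Conjugate Coxeter elements have the same number of forward arcs on every cycle. -/
theorem sum_perm_eq_of_isConj (cs : CoxeterSystem M W) {n : ℕ} {key key' : B → Fin n}
    (hinj : key.Injective) (hinj' : key'.Injective)
    {l l' : List B} (hl : l.Pairwise fun i j => key i < key j)
    (hl' : l'.Pairwise fun i j => key' i < key' j) (hmem : ∀ i, i ∈ l) (hmem' : ∀ i, i ∈ l')
    (hconj : IsConj (cs.wordProd l) (cs.wordProd l')) {τ : Equiv.Perm B}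
    (hτ : ∀ i, τ i ≠ i → M.coxeterGraph.Adj i (τ i) ∧ τ (τ i) ≠ i) :
    ∑ i, (if key i ≤ key (τ i) then 1 else 0 : ℤ) =
      ∑ i, if key' i ≤ key' (τ i) then 1 else 0 := by
  obtain ⟨a, ha, h⟩ := exists_tendsto_det_coxeterPencil hinj hτ
  obtain ⟨a', ha', h'⟩ := exists_tendsto_det_coxeterPencil hinj' hτ
  have hev : ∀ᶠ T : ℝ in Filter.atTop, (coxeterPencil
      (M.cartan fun i j => T ^ ((Fintype.card B + 1) * permFlow τ i j)) key T).det =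
      (coxeterPencil
      (M.cartan fun i j => T ^ ((Fintype.card B + 1) * permFlow τ i j)) key' T).det := by
    filter_upwards [Filter.eventually_ne_atTop 0] with T hT
    refine det_coxeterPencil_eq_of_isConj (fun i j _ => ?_) cs hinj hinj' hl hl' hmem hmem' hconj T
    -- `permFlow` is antisymmetric, so opposite weights multiply to 1.
    rw [← zpow_add₀ hT, permFlow, permFlow]
    ring_nf
    exact zpow_zero T
  have h'' := h.congr' (hev.mono fun T hT => congrArg (· * _) hT)
  have := le_antisymm (le_of_tendsto_mul_zpow ha h' h'') (le_of_tendsto_mul_zpow ha' h'' h')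
  -- The flow part of the exponent does not involve the order and cancels.
  rw [Finset.sum_add_distrib, Finset.sum_add_distrib] at this
  exact add_right_cancel this

end CoxeterMatrix

/-! ### Clicks and coboundaries -/

namespace AcyclicOrientation

variable {V : Type*} {Γ : SimpleGraph V}

theorem arc_adj (O : AcyclicOrientation Γ) {u v : V} (h : O.arc u v) : Γ.Adj u v :=
  (O.adj_iff u v).2 (Or.inl h)

theorem arc_asymm (O : AcyclicOrientation Γ) {u v : V} (h : O.arc u v) : ¬ O.arc v u :=
  fun h' => O.acyclic u (.tail (.single h) h')

theorem arc_iff_of_adj (O : AcyclicOrientation Γ) {u v : V} (h : Γ.Adj u v) :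
    O.arc u v ↔ ¬ O.arc v u :=
  ⟨O.arc_asymm, ((O.adj_iff u v).1 h).resolve_right⟩

/-- The orientation obtained by turning a source into a sink. -/
def click (O : AcyclicOrientation Γ) (v : V) (hv : O.IsSource v) : AcyclicOrientation Γ where
  arc u w := ((u ≠ v ∧ w ≠ v) ∧ O.arc u w) ∨ ((u = v ∨ w = v) ∧ O.arc w u)
  adj_iff u w := by
    rw [O.adj_iff]
    tauto
  acyclic := by
    have hsrc (w : V) : ¬ (((v ≠ v ∧ w ≠ v) ∧ O.arc v w) ∨ ((v = v ∨ w = v) ∧ O.arc w v)) := by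
      rintro (h | h)
      · exact h.1.1 rfl
      · exact hv w h.2
    -- After the click v is a sink, so a directed path can meet v only at its end, unless it already
    -- was a path of `O`.
    have key (a b : V) (h : Relation.TransGen (fun u w =>
        ((u ≠ v ∧ w ≠ v) ∧ O.arc u w) ∨ ((u = v ∨ w = v) ∧ O.arc w u)) a b) :
        b = v ∧ a ≠ v ∨ Relation.TransGen O.arc a b := by
      have hstep (a b : V) (h : ((a ≠ v ∧ b ≠ v) ∧ O.arc a b) ∨
          ((a = v ∨ b = v) ∧ O.arc b a)) : b = v ∧ a ≠ v ∨ O.arc a b := by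
        rcases h with h | ⟨ha | hb, h⟩
        · exact Or.inr h.2
        · exact absurd (ha ▸ h) (hv b)
        · exact Or.inl ⟨hb, fun ha => hv b (ha ▸ h)⟩
      induction h with
      | single h => exact (hstep _ _ h).imp_right .single
      | @tail b c h1 h2 ih =>
        rcases ih with ⟨rfl, -⟩ | ih
        · exact absurd h2 (hsrc c)
        · rcases hstep _ _ h2 with ⟨rfl, -⟩ | h
          · refine Or.inl ⟨rfl, ?_⟩
            rintro rfl
            obtain ⟨d, hd, -⟩ := Relation.TransGen.head'_iff.1 h1
            exact hsrc d hd
          · exact Or.inr (ih.tail h)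
    intro a h
    rcases key a a h with h | h
    · exact h.2 h.1
    · exact O.acyclic a h

theorem click_spec (O : AcyclicOrientation Γ) {v : V} (hv : O.IsSource v) :
    Click O (O.click v hv) := ⟨v, hv, fun _ _ => Iff.rfl⟩

open Classical in
/-- If the indicator functions of two acyclic orientations differ by the coboundary of `h`, then
clicking every vertex `v` altogether `h v` times in a suitable order leads from one to the other. -/
theorem kappaEquiv_of_coboundary [Fintype V] (h : V → ℕ) (O O' : AcyclicOrientation Γ)
    (hd : ∀ u v, Γ.Adj u v → (if O.arc u v then 1 else 0 : ℤ) - (if O'.arc u v then 1 else 0) =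
      h u - h v) : KappaEquiv O O' := by
  induction hn : ∑ v, h v generalizing h O with
  | zero =>
    have h0 : ∀ v, h v = 0 := by simpa using hn
    have : O = O' := by
      ext u v
      by_cases ha : Γ.Adj u v
      · have := hd u v ha
        by_cases h1 : O.arc u v <;> by_cases h2 : O'.arc u v <;> simp [h1, h2, h0] at this ⊢
      · exact ⟨fun h => absurd (O.arc_adj h) ha, fun h => absurd (O'.arc_adj h) ha⟩
    rw [this]
    exact Relation.ReflTransGen.refl
  | succ n ih =>
    have hex : ∃ v, 0 < h v := by
      by_contra hcon
      push Not at hcon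
      have : ∑ v, h v = 0 := Finset.sum_eq_zero fun v _ => Nat.le_zero.1 (hcon v)
      omega
    obtain ⟨v₀, hv₀⟩ := hex
    obtain ⟨m, -, hm⟩ := Finset.exists_max_image Finset.univ h ⟨v₀, Finset.mem_univ _⟩
    have hwf : WellFounded (Relation.TransGen O.arc) := by
      have : IsTrans V (Relation.TransGen O.arc) := ⟨fun _ _ _ => Relation.TransGen.trans⟩
      have : Std.Irrefl (Relation.TransGen O.arc) := ⟨O.acyclic⟩
      exact Finite.wellFounded_of_trans_of_irrefl _
    -- Take a vertex that comes first in `O` on the top level set of h. An arc u → v would force h u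
    -- ≥ h v by `hd`, placing u on that level too; so v is a source and can be clicked.
    obtain ⟨v, hv, hmin⟩ := hwf.has_min {v | h m ≤ h v} ⟨m, le_refl (h m)⟩
    have hpos : 0 < h v := (hv₀.trans_le (hm v₀ (Finset.mem_univ _))).trans_le hv
    have hsrc : O.IsSource v := by
      intro u hu
      refine hmin u ?_ (.single hu)
      have := hd v u (O.arc_adj hu).symm
      rw [if_neg (O.arc_asymm hu)] at this
      have : (h v : ℤ) - h u ≤ 0 := by rw [← this]; split_ifs <;> simp
      have : h m ≤ h v := hv
      change h m ≤ h u
      omega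
    refine Relation.ReflTransGen.head (O.click_spec hsrc)
      (ih (Function.update h v (h v - 1)) (O.click v hsrc) (fun u w huw => ?_) ?_)
    · have hd' := hd u w huw
      have hne := huw.ne
      by_cases hu : u = v
      · subst hu
        have h1 : O.arc u w := (O.arc_iff_of_adj huw).2 (hsrc w)
        have h2 : ¬ (O.click u hsrc).arc u w := by
          simp [click, hsrc w]
        rw [if_pos h1] at hd'
        rw [if_neg h2, Function.update_self, Function.update_of_ne hne.symm]
        push_cast [Nat.sub_add_cancel hpos, hpos]
        omega
      · by_cases hw : w = v
        · subst hw
          have h1 : (O.click w hsrc).arc u w :=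
            Or.inr ⟨Or.inr rfl, (O.arc_iff_of_adj huw.symm).2 (hsrc u)⟩
          rw [if_neg (hsrc u)] at hd'
          rw [if_pos h1, Function.update_self, Function.update_of_ne hne]
          omega
        · have : (O.click v hsrc).arc u w ↔ O.arc u w := by simp [click, hu, hw]
          simp only [this, Function.update_of_ne hu, Function.update_of_ne hw]
          exact hd'
    · rw [Finset.sum_update_of_mem (Finset.mem_univ v)]
      rw [← Finset.add_sum_erase _ _ (Finset.mem_univ v)] at hn
      rw [Finset.sdiff_singleton_eq_erase]
      omega

end AcyclicOrientation

/-! ### Integrating edge functions along walks -/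

namespace SimpleGraph

variable {V : Type*} {G : SimpleGraph V}

/-- The sum of an edge function along a walk. -/
def Walk.dartSum (d : V → V → ℤ) : {u v : V} → G.Walk u v → ℤ
  | _, _, .nil => 0
  | _, _, .cons' u v _ _ p => d u v + p.dartSum d

theorem Walk.dartSum_append (d : V → V → ℤ) {u v w : V} (p : G.Walk u v) (q : G.Walk v w) :
    (p.append q).dartSum d = p.dartSum d + q.dartSum d := by
  induction p with
  | nil => simp [dartSum]
  | cons h p ih => simp [dartSum, ih, add_assoc]

theorem Walk.dartSum_reverse {d : V → V → ℤ} (hd : ∀ u v, d u v = -d v u) {u v : V}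
    (p : G.Walk u v) : p.reverse.dartSum d = -p.dartSum d := by
  induction p with
  | nil => simp [dartSum]
  | @cons u v w h p ih => simp [dartSum, dartSum_append, ih, hd v u]

theorem Walk.dartSum_copy (d : V → V → ℤ) {u v u' v' : V} (p : G.Walk u v) (hu : u = u')
    (hv : v = v') : (p.copy hu hv).dartSum d = p.dartSum d := by
  subst hu hv
  rfl

/-- The potential at v is the sum along a walk from v to a chosen representative of its component;
vanishing on closed walks makes it independent of the walk. -/
theorem exists_coboundary_of_dartSum_eq_zero {d : V → V → ℤ} (hd : ∀ u v, d u v = -d v u)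
    (h : ∀ (v : V) (p : G.Walk v v), p.dartSum d = 0) :
    ∃ g : V → ℤ, ∀ u v, G.Adj u v → d u v = g u - g v := by
  have hreach (v : V) : G.Reachable v (G.connectedComponentMk v).out :=
    ConnectedComponent.exact (Quot.out_eq (G.connectedComponentMk v)).symm
  refine ⟨fun v => (hreach v).some.dartSum d, fun u v huv => ?_⟩
  have hc : (G.connectedComponentMk v).out = (G.connectedComponentMk u).out := by
    rw [ConnectedComponent.connectedComponentMk_eq_of_adj huv]
  have := h u (.cons huv (((hreach v).some.copy rfl hc).append (hreach u).some.reverse))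
  rw [Walk.dartSum, Walk.dartSum_append, Walk.dartSum_reverse hd, Walk.dartSum_copy] at this
  linarith

theorem Walk.dartSum_eq_sum_getVert (d : V → V → ℤ) {u v : V} (p : G.Walk u v) :
    p.dartSum d = ∑ i ∈ Finset.range p.length, d (p.getVert i) (p.getVert (i + 1)) := by
  induction p with
  | nil => simp [dartSum]
  | cons h p ih => simp [dartSum, ih, Finset.sum_range_succ']; ring

/-- If an antisymmetric edge function sums to zero over every cyclic permutation of vertices along
edges of the graph, then it sums to zero over every closed walk. -/
theorem sum_closed_eq_zero [Fintype V] {d : V → V → ℤ} (hd : ∀ u v, d u v = -d v u)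
    (h : ∀ τ : Equiv.Perm V, (∀ i, τ i ≠ i → G.Adj i (τ i) ∧ τ (τ i) ≠ i) →
      ∑ i, d i (τ i) = 0) (k : ℕ) (p : ℕ → V) (hp : p k = p 0)
    (hadj : ∀ i < k, G.Adj (p i) (p (i + 1))) :
    ∑ i ∈ Finset.range k, d (p i) (p (i + 1)) = 0 := by
  classical
  have hself (v : V) : d v v = 0 := by have := hd v v; omega
  induction k using Nat.strong_induction_on generalizing p with
  | _ k ih =>
  by_cases hinj : ∀ i j, i < j → j < k → p i ≠ p j
  · rcases lt_or_ge k 3 with hk | hk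
    · interval_cases k
      · simp
      · simp [hp, hself]
      · rw [Finset.sum_range_succ, Finset.sum_range_one, hp, hd (p 1)]
        ring
    -- A closed walk of length at least 3 with distinct vertices is the cycle of a permutation, to
    -- which `h` applies; shorter ones vanish by antisymmetry.
    · set l := List.ofFn fun i : Fin k => p i with hl
      have hlen : l.length = k := by simp [hl]
      have hget (i : ℕ) (hi : i < k) : l[i]'(by omega) = p i := by simp [hl]
      have hnd : l.Nodup := by
        rw [hl, List.nodup_ofFn]
        intro a b hab
        rcases lt_trichotomy a b with hlt | rfl | hlt
        · exact absurd hab (hinj a b hlt b.2)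
        · rfl
        · exact absurd hab.symm (hinj b a hlt a.2)
      have hτ (i : ℕ) (hi : i < k) : l.formPerm (p i) = p ((i + 1) % k) := by
        have := List.formPerm_apply_getElem l hnd i (by omega)
        simp only [hlen] at this
        rw [hget i hi, hget _ (Nat.mod_lt _ (by omega))] at this
        exact this
      have hmod (i : ℕ) (hi : i < k) : p ((i + 1) % k) = p (i + 1) := by
        rcases (show i + 1 ≤ k from hi).lt_or_eq with hlt | heq
        · rw [Nat.mod_eq_of_lt hlt]
        · rw [heq, Nat.mod_self, hp]
      have hpinj {a b : ℕ} (ha : a < k) (hb : b < k) (hab : p a = p b) : a = b := by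
        rcases lt_trichotomy a b with hlt | rfl | hlt
        · exact absurd hab (hinj a b hlt hb)
        · rfl
        · exact absurd hab.symm (hinj b a hlt ha)
      have hmem (v : V) : v ∈ l ↔ ∃ i < k, p i = v := by
        rw [hl, List.mem_ofFn]
        exact ⟨fun ⟨i, hi⟩ => ⟨i, i.2, hi⟩, fun ⟨i, hi, e⟩ => ⟨⟨i, hi⟩, e⟩⟩
      have hsum := h l.formPerm fun v hv => by
        have hvl : v ∈ l := by
          by_contra hn
          exact hv (List.formPerm_apply_of_notMem hn)
        obtain ⟨i, hi, rfl⟩ := (hmem v).1 hvl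
        refine ⟨?_, ?_⟩
        · rw [hτ i hi, hmod i hi]
          exact hadj i hi
        · rw [hτ i hi, hτ _ (Nat.mod_lt _ (by omega))]
          intro e
          have := hpinj (Nat.mod_lt _ (by omega)) hi e
          rw [Nat.mod_add_mod] at this
          rcases lt_or_ge (i + 1 + 1) k with hlt | hge
          · rw [Nat.mod_eq_of_lt hlt] at this; omega
          · rw [Nat.mod_eq_sub_mod hge, Nat.mod_eq_of_lt (by omega)] at this
            omega
      rw [← hsum, ← Finset.sum_subset (Finset.subset_univ l.toFinset)]
      · symm
        have himg : l.toFinset = (Finset.range k).image p := by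
          ext v
          simp [hmem]
        rw [himg, Finset.sum_image]
        · refine Finset.sum_congr rfl fun i hi => ?_
          rw [hτ i (Finset.mem_range.1 hi), hmod i (Finset.mem_range.1 hi)]
        · intro a ha b hb hab
          exact hpinj (by simpa using ha) (by simpa using hb) hab
      · intro v _ hv
        rw [List.formPerm_apply_of_notMem (by simpa using hv), hself]
  · push Not at hinj
    obtain ⟨a, b, hab, hbk, hpab⟩ := hinj
    obtain ⟨m, rfl⟩ := Nat.exists_eq_add_of_lt hab
    obtain ⟨n, rfl⟩ := Nat.exists_eq_add_of_lt hbk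
    have inner := ih (m + 1) (by omega) (fun i => p (a + i)) hpab.symm
      (fun i hi => hadj (a + i) (by omega))
    -- At a repeated vertex the walk splits into an inner loop and the walk q that skips it. At
    -- index a both branches of q agree, because p takes the same value at both ends of the loop.
    let q : ℕ → V := fun i => if i ≤ a then p i else p (i + (m + 1))
    have hq1 (i : ℕ) (hi : i ≤ a) : q i = p i := if_pos hi
    have hq2 (i : ℕ) (hi : a ≤ i) : q i = p (i + (m + 1)) := by
      rcases hi.eq_or_lt with rfl | hi
      · rw [hq1 _ le_rfl, hpab]; rfl
      · exact if_neg (by omega)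
    have outer := ih (a + (n + 1)) (by omega) q
      (by rw [hq2 _ (by omega), hq1 0 (by omega), ← hp]; congr 1; ring)
      (fun i hi => by
        rcases lt_or_ge i a with h1 | h1
        · rw [hq1 i h1.le, hq1 (i + 1) h1]
          exact hadj i (by omega)
        · rw [hq2 i h1, hq2 (i + 1) (by omega), add_right_comm]
          exact hadj _ (by omega))
    rw [Finset.sum_range_add] at outer
    rw [show a + m + 1 + n + 1 = a + (m + 1) + (n + 1) by ring, Finset.sum_range_add,
      Finset.sum_range_add]
    have e1 : ∑ i ∈ Finset.range a, d (q i) (q (i + 1)) =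
        ∑ i ∈ Finset.range a, d (p i) (p (i + 1)) :=
      Finset.sum_congr rfl fun i hi => by
        have := Finset.mem_range.1 hi
        rw [hq1 i this.le, hq1 (i + 1) this]
    have e2 : ∑ i ∈ Finset.range (n + 1), d (q (a + i)) (q (a + i + 1)) =
        ∑ i ∈ Finset.range (n + 1), d (p (a + (m + 1) + i)) (p (a + (m + 1) + i + 1)) :=
      Finset.sum_congr rfl fun i _ => by
        rw [hq2 (a + i) (by omega), hq2 (a + i + 1) (by omega)]
        congr 2 <;> ring
    rw [e1, e2] at outer
    have inner' : ∑ i ∈ Finset.range (m + 1), d (p (a + i)) (p (a + i + 1)) = 0 := inner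
    rw [inner', add_zero]
    exact outer

theorem exists_coboundary_of_sum_perm_eq_zero [Fintype V] {d : V → V → ℤ}
    (hd : ∀ u v, d u v = -d v u)
    (h : ∀ τ : Equiv.Perm V, (∀ i, τ i ≠ i → G.Adj i (τ i) ∧ τ (τ i) ≠ i) →
      ∑ i, d i (τ i) = 0) :
    ∃ g : V → ℤ, ∀ u v, G.Adj u v → d u v = g u - g v :=
  exists_coboundary_of_dartSum_eq_zero hd fun v p => by
    rw [Walk.dartSum_eq_sum_getVert]
    refine sum_closed_eq_zero hd h _ p.getVert (by simp) fun i hi => ?_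
    exact p.adj_getVert_succ hi

end SimpleGraph

/-! ### Words, orders and orientations -/

namespace CoxeterSystem

variable {B W : Type*} [Group W] {M : CoxeterMatrix B} (cs : CoxeterSystem M W)

theorem commute_simple_of_not_adj {i j : B} (hij : i ≠ j) (h : ¬ M.coxeterGraph.Adj i j) :
    Commute (cs.simple i) (cs.simple j) := by
  have h2 : M i j = 2 := by by_contra h2; exact h ⟨hij, h2⟩
  have := cs.simple_mul_simple_pow i j
  rw [h2, pow_two, mul_eq_one_iff_eq_inv, mul_inv_rev, cs.inv_simple, cs.inv_simple] at this
  exact this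

theorem commute_simple_wordProd {i : B} {l : List B}
    (h : ∀ j ∈ l, Commute (cs.simple i) (cs.simple j)) :
    Commute (cs.simple i) (cs.wordProd l) := by
  refine Commute.list_prod_right _ _ fun x hx => ?_
  obtain ⟨j, hj, rfl⟩ := List.mem_map.1 hx
  exact h j hj

/-- Words with the same letters in which adjacent generators appear in the same order represent the
same element. -/
theorem wordProd_eq_of_perm {P P' : Type*} [LinearOrder P] [LinearOrder P'] {key : B → P}
    {key' : B → P'} {l l' : List B} (hl : l.Pairwise fun i j => key i < key j)
    (hl' : l'.Pairwise fun i j => key' i < key' j) (hperm : l.Perm l')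
    (h : ∀ i ∈ l, ∀ j ∈ l, M.coxeterGraph.Adj i j → key i < key j → key' i < key' j) :
    cs.wordProd l = cs.wordProd l' := by
  induction l generalizing l' with
  | nil => rw [List.nil_perm.1 hperm]
  | cons a t ih =>
    obtain ⟨l₁, l₂, rfl⟩ := List.append_of_mem (hperm.subset List.mem_cons_self)
    have ht : t.Perm (l₁ ++ l₂) := (hperm.trans List.perm_middle).cons_inv
    rw [List.pairwise_cons] at hl
    -- The letter a comes first in one word, so any neighbour follows it in both words; what
    -- precedes a in the other word commutes with it.
    have hcomm : Commute (cs.simple a) (cs.wordProd l₁) := by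
      refine cs.commute_simple_wordProd fun x hx => ?_
      have hxa : key' x < key' a := (List.pairwise_append.1 hl').2.2 x hx a List.mem_cons_self
      have hxt : x ∈ t := ht.symm.subset (List.mem_append_left _ hx)
      refine cs.commute_simple_of_not_adj (by rintro rfl; exact lt_irrefl _ hxa) fun hadj => ?_
      exact hxa.not_gt (h a List.mem_cons_self x (List.mem_cons_of_mem _ hxt) hadj (hl.1 x hxt))
    have hsub : (l₁ ++ l₂).Sublist (l₁ ++ a :: l₂) :=
      (List.Sublist.refl _).append (List.sublist_cons_self _ _)
    rw [cs.wordProd_cons, ih hl.2 (hl'.sublist hsub) ht fun i hi j hj =>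
      h i (List.mem_cons_of_mem _ hi) j (List.mem_cons_of_mem _ hj), cs.wordProd_append,
      cs.wordProd_append, cs.wordProd_cons, ← mul_assoc, ← mul_assoc, hcomm.eq]

theorem pairwise_ofFn_symm {n : ℕ} (π : Fin n ≃ B) :
    (List.ofFn π).Pairwise fun i j => π.symm i < π.symm j := by
  rw [List.pairwise_ofFn]
  intro i j hij
  simpa using hij

theorem mem_ofFn_equiv {n : ℕ} (π : Fin n ≃ B) (i : B) : i ∈ List.ofFn π :=
  List.mem_ofFn.2 (π.surjective i)

theorem nodup_ofFn_equiv {n : ℕ} (π : Fin n ≃ B) : (List.ofFn π).Nodup :=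
  List.nodup_ofFn.2 π.injective

theorem perm_ofFn_equiv {n m : ℕ} (π : Fin n ≃ B) (π' : Fin m ≃ B) :
    (List.ofFn π).Perm (List.ofFn π') :=
  (List.perm_ext_iff_of_nodup (nodup_ofFn_equiv π) (nodup_ofFn_equiv π')).2 fun i => by
    simp only [mem_ofFn_equiv]

/-- A product of all generators determines the order of adjacent generators: this is read off from
a realization with linearly independent coroots. -/
theorem lt_of_wordProd_eq [Finite B] {P : Type*} [LinearOrder P] {key key' : B → P}
    (hinj : key.Injective) {l l' : List B} (hl : l.Pairwise fun i j => key i < key j)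
    (hl' : l'.Pairwise fun i j => key' i < key' j) (hmem : ∀ i, i ∈ l) (hmem' : ∀ i, i ∈ l')
    (h : cs.wordProd l = cs.wordProd l') {i j : B} (hadj : M.coxeterGraph.Adj i j)
    (hij : key i < key j) : key' i < key' j := by
  classical
  have := Fintype.ofFinite B
  let A := M.cartan fun _ _ => 1
  -- The Cartan matrix may be singular. The second factor makes the forms independent too, so that a
  -- vector can have any prescribed values under them.
  let α : B → (B → ℝ) × (B → ℝ) := fun i => (Pi.single i 1, 0)
  let f : B → Module.Dual ℝ ((B → ℝ) × (B → ℝ)) := fun i =>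
    (LinearMap.proj i ∘ₗ A.mulVecLin).coprod (LinearMap.proj i)
  have hf (i j : B) : f i (α j) = A i j := by simp [f, α]
  have hr : M.IsRealization α f := CoxeterMatrix.isRealization_of_cartan (by simp) hf
  let U : Matrix B B ℝ := 1 + .of fun i j => if key i < key j then A i j else 0
  -- The test vector has column j of U as its form values, so the triangular system of the first
  -- order has solution e_j. Row i of the system of the second order then gives A_ij = 0 unless i
  -- precedes j there as well.
  obtain ⟨u, -, hu, hU⟩ := hr.exists_toHom_wordProd cs key l hl (0, fun i => U i j)
  obtain ⟨u', -, hu', hU'⟩ := hr.exists_toHom_wordProd cs key' l' hl' (0, fun i => U i j)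
  have hfst (v : B → ℝ) : (∑ i, v i • α i).1 = v := by
    rw [Prod.fst_sum]
    ext k
    simp [α, Finset.sum_apply, Pi.single_apply]
  have huu : u = u' := by
    rw [h, hu'] at hu
    have := congrArg Prod.fst (sub_right_injective hu)
    rw [hfst, hfst] at this
    exact this.symm
  subst huu
  have huj : u = Pi.single j 1 := by
    rw [← sub_eq_zero]
    refine Matrix.eq_zero_of_mulVec_eq_zero (M := U) ?_ ?_
    · rw [Matrix.det_one_add_upper A hinj]
      exact one_ne_zero
    · rw [Matrix.mulVec_sub, sub_eq_zero]
      ext k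
      have := hU k (hmem k)
      simp only [hf] at this
      rw [Matrix.mulVec_single_one, Matrix.add_mulVec, Matrix.one_mulVec]
      refine Eq.trans ?_ (this.trans ?_)
      · simp [Matrix.mulVec, dotProduct]
      · simp [f]
  by_contra hlt
  have h1 := hU' i (hmem' i)
  rw [huj] at h1
  have hne : A i j ≠ 0 := by
    simp [A, CoxeterMatrix.cartan_of_adj hadj, (M.cos_pi_div_pos hadj).ne']
  apply hne
  simpa [f, hf, U, hadj.1, hij, hlt, Pi.single_apply, eq_comm] using h1

theorem ofOrder_eq_of_orderedProd_eq [Finite B] {n : ℕ} {π π' : Fin n ≃ B}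
    (h : cs.orderedProd π = cs.orderedProd π') :
    AcyclicOrientation.ofOrder M.coxeterGraph π = .ofOrder M.coxeterGraph π' := by
  ext u v
  refine and_congr_right fun hadj => ⟨fun huv => ?_, fun huv => ?_⟩
  · exact cs.lt_of_wordProd_eq π.symm.injective (pairwise_ofFn_symm π) (pairwise_ofFn_symm π')
      (mem_ofFn_equiv π) (mem_ofFn_equiv π') h hadj huv
  · exact cs.lt_of_wordProd_eq π'.symm.injective (pairwise_ofFn_symm π') (pairwise_ofFn_symm π)
      (mem_ofFn_equiv π') (mem_ofFn_equiv π) h.symm hadj huv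

theorem orderedProd_eq_of_ofOrder_eq {n : ℕ} {π π' : Fin n ≃ B}
    (h : AcyclicOrientation.ofOrder M.coxeterGraph π = .ofOrder M.coxeterGraph π') :
    cs.orderedProd π = cs.orderedProd π' :=
  cs.wordProd_eq_of_perm (pairwise_ofFn_symm π) (pairwise_ofFn_symm π') (perm_ofFn_equiv π π')
    fun i _ j _ hadj hij => by
      have : (AcyclicOrientation.ofOrder M.coxeterGraph π).arc i j := ⟨hadj, hij⟩
      rw [h] at this
      exact this.2

theorem _root_.AcyclicOrientation.exists_ofOrder_eq {V : Type*} [Finite V] {Γ : SimpleGraph V}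
    (O : AcyclicOrientation Γ) : ∃ π : Fin (Nat.card V) ≃ V, .ofOrder Γ π = O := by
  classical
  have := Fintype.ofFinite V
  have : IsPartialOrder V (Relation.ReflTransGen O.arc) :=
    { refl := fun _ => .refl
      trans := fun _ _ _ => .trans
      antisymm := fun a b hab hba => by
        by_contra hne
        exact O.acyclic a (((Relation.reflTransGen_iff_eq_or_transGen.1 hab).resolve_left
          (Ne.symm hne)).trans_left hba) }
  obtain ⟨s, hs, hle⟩ := extend_partialOrder (Relation.ReflTransGen O.arc)
  let _ : LinearOrder V :=
    { le := s
      le_refl := hs.refl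
      le_trans := hs.trans
      le_antisymm := hs.antisymm
      le_total := hs.total
      toDecidableLE := Classical.decRel s }
  let π := Fintype.orderIsoFinOfCardEq V (Nat.card_eq_fintype_card (α := V)).symm
  have hlt {u v : V} (h : O.arc u v) : π.symm u < π.symm v := by
    rw [OrderIso.lt_iff_lt]
    exact lt_of_le_of_ne (hle u v (.single h)) (O.arc_adj h).ne
  refine ⟨π.toEquiv, ?_⟩
  ext u v
  constructor
  · rintro ⟨hadj, h⟩
    refine (O.arc_iff_of_adj hadj).2 fun h' => ?_
    exact lt_asymm h (hlt h')
  · exact fun h => ⟨O.arc_adj h, hlt h⟩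

/-- A source commutes to the front of its word and the resulting sink to the end of the other; the
remaining letters spell the same element r, so the two products are s_v r and r s_v. -/
theorem isConj_of_click {n : ℕ} {π π' : Fin n ≃ B}
    (h : AcyclicOrientation.Click (.ofOrder M.coxeterGraph π) (.ofOrder M.coxeterGraph π')) :
    IsConj (cs.orderedProd π) (cs.orderedProd π') := by
  obtain ⟨v, hv, hO⟩ := h
  obtain ⟨l₁, l₂, hl⟩ := List.append_of_mem (mem_ofFn_equiv π v)
  obtain ⟨r₁, r₂, hr⟩ := List.append_of_mem (mem_ofFn_equiv π' v)
  have hlp := pairwise_ofFn_symm π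
  have hrp := pairwise_ofFn_symm π'
  have hnd := nodup_ofFn_equiv π
  rw [hl] at hlp hnd
  rw [hr] at hrp
  have hlsub : (l₁ ++ l₂).Sublist (l₁ ++ v :: l₂) :=
    (List.Sublist.refl _).append (List.sublist_cons_self _ _)
  have hrsub : (r₁ ++ r₂).Sublist (r₁ ++ v :: r₂) :=
    (List.Sublist.refl _).append (List.sublist_cons_self _ _)
  have hvl : v ∉ l₁ ++ l₂ := (List.nodup_middle.1 hnd).notMem
  have hperm : (l₁ ++ l₂).Perm (r₁ ++ r₂) := by
    have := perm_ofFn_equiv π π'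
    rw [hl, hr] at this
    exact (List.perm_middle.symm.trans (this.trans List.perm_middle)).cons_inv
  have hrest : cs.wordProd (l₁ ++ l₂) = cs.wordProd (r₁ ++ r₂) := by
    refine cs.wordProd_eq_of_perm (hlp.sublist hlsub) (hrp.sublist hrsub) hperm
      fun i hi j hj hadj hij => ?_
    refine ((hO i j).2 (Or.inl ⟨⟨?_, ?_⟩, hadj, hij⟩)).2
    · rintro rfl; exact hvl hi
    · rintro rfl; exact hvl hj
  have h1 : Commute (cs.simple v) (cs.wordProd l₁) := by
    refine cs.commute_simple_wordProd fun x hx => ?_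
    have hxv := (List.pairwise_append.1 hlp).2.2 x hx v List.mem_cons_self
    refine cs.commute_simple_of_not_adj (by rintro rfl; exact lt_irrefl _ hxv) fun hadj => ?_
    exact hv x ⟨hadj.symm, hxv⟩
  have h2 : Commute (cs.simple v) (cs.wordProd r₂) := by
    refine cs.commute_simple_wordProd fun x hx => ?_
    have hvx := (List.pairwise_cons.1 (List.pairwise_append.1 hrp).2.1).1 x hx
    refine cs.commute_simple_of_not_adj (by rintro rfl; exact lt_irrefl _ hvx) fun hadj => ?_
    rcases (hO v x).1 ⟨hadj, hvx⟩ with h | h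
    · exact h.1.1 rfl
    · exact hv x h.2
  have e1 : cs.orderedProd π = cs.simple v * cs.wordProd (l₁ ++ l₂) := by
    rw [orderedProd, hl, cs.wordProd_append, cs.wordProd_cons, cs.wordProd_append, ← mul_assoc,
      ← mul_assoc, h1.eq]
  have e2 : cs.orderedProd π' = cs.wordProd (l₁ ++ l₂) * cs.simple v := by
    rw [hrest, orderedProd, hr, cs.wordProd_append, cs.wordProd_cons, cs.wordProd_append,
      mul_assoc, h2.eq]
  rw [e1, e2]
  exact isConj_iff.2 ⟨cs.simple v, by simp⟩

theorem isConj_of_kappaEquiv [Finite B] {π π' : Fin (Nat.card B) ≃ B}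
    (h : AcyclicOrientation.KappaEquiv (.ofOrder M.coxeterGraph π) (.ofOrder M.coxeterGraph π')) :
    IsConj (cs.orderedProd π) (cs.orderedProd π') := by
  generalize hO : AcyclicOrientation.ofOrder M.coxeterGraph π' = O at h
  induction h generalizing π' with
  | refl => rw [cs.orderedProd_eq_of_ofOrder_eq hO]
  | @tail O₁ O₂ _ hstep ih =>
    obtain ⟨ρ, hρ⟩ := O₁.exists_ofOrder_eq
    refine (ih hρ).trans (cs.isConj_of_click ?_)
    rwa [hρ, hO]

theorem kappaEquiv_of_isConj [Finite B] {n : ℕ} {π π' : Fin n ≃ B}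
    (h : IsConj (cs.orderedProd π) (cs.orderedProd π')) :
    AcyclicOrientation.KappaEquiv (.ofOrder M.coxeterGraph π) (.ofOrder M.coxeterGraph π') := by
  classical
  have := Fintype.ofFinite B
  let d : B → B → ℤ := fun i j => (if π.symm i ≤ π.symm j then 1 else 0) -
    if π'.symm i ≤ π'.symm j then 1 else 0
  have hkey (ρ : Fin n ≃ B) {i j : B} (hij : i ≠ j) : (if ρ.symm i ≤ ρ.symm j then 1 else 0 : ℤ) =
      1 - if ρ.symm j ≤ ρ.symm i then 1 else 0 := by
    rcases lt_or_gt_of_ne (ρ.symm.injective.ne hij) with h | h <;> simp [h.le, h.not_ge]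
  have hd (i j : B) : d i j = -d j i := by
    obtain rfl | hij := eq_or_ne i j
    · simp [d]
    · simp only [d]
      rw [hkey π hij, hkey π' hij]
      ring
  obtain ⟨g, hg⟩ := SimpleGraph.exists_coboundary_of_sum_perm_eq_zero (G := M.coxeterGraph) hd
    fun τ hτ => by
      simp only [d]
      rw [Finset.sum_sub_distrib, sub_eq_zero]
      exact CoxeterMatrix.sum_perm_eq_of_isConj cs π.symm.injective π'.symm.injective
        (pairwise_ofFn_symm π) (pairwise_ofFn_symm π') (mem_ofFn_equiv π) (mem_ofFn_equiv π') h hτ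
  -- Only differences of the potential matter, so subtracting a lower bound turns it into numbers of
  -- clicks.
  obtain ⟨m, hm⟩ : ∃ m : ℤ, ∀ i, m ≤ g i := by
    obtain ⟨m, hm⟩ := (Set.finite_range g).bddBelow
    exact ⟨m, fun i => hm ⟨i, rfl⟩⟩
  refine AcyclicOrientation.kappaEquiv_of_coboundary (fun i => (g i - m).toNat) _ _
    fun u v huv => ?_
  have harc (ρ : Fin n ≃ B) : (AcyclicOrientation.ofOrder M.coxeterGraph ρ).arc u v ↔
      ρ.symm u ≤ ρ.symm v :=
    ⟨fun h => h.2.le, fun h => ⟨huv, h.lt_of_ne (ρ.symm.injective.ne huv.ne)⟩⟩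
  rw [Int.toNat_of_nonneg (sub_nonneg.2 (hm u)), Int.toNat_of_nonneg (sub_nonneg.2 (hm v))]
  simp only [harc]
  have := hg u v huv
  simp only [d] at this
  rw [this]
  ring

end CoxeterSystem

theorem theorem3 {B W : Type*} [Finite B] [Group W] {M : CoxeterMatrix B}
    (cs : CoxeterSystem M W) :
    ∃ f : cs.coxeterElements ≃ AcyclicOrientation M.coxeterGraph,
      (∀ (π : Fin (Nat.card B) ≃ B) (c : cs.coxeterElements), (c : W) = cs.orderedProd π →
        f c = AcyclicOrientation.ofOrder M.coxeterGraph π) ∧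
      (∀ c c' : cs.coxeterElements,
        IsConj (c : W) (c' : W) ↔ AcyclicOrientation.KappaEquiv (f c) (f c')) ∧
      (ConjClasses.mk '' cs.coxeterElements).ncard = M.coxeterGraph.kappa := by
  choose order horder using fun c : cs.coxeterElements => c.2
  have horder (c : cs.coxeterElements) : cs.orderedProd (order c) = c := horder c
  let F (c : cs.coxeterElements) := AcyclicOrientation.ofOrder M.coxeterGraph (order c)
  -- The orientation does not depend on the order chosen to represent c.
  have hF (π : Fin (Nat.card B) ≃ B) (c : cs.coxeterElements) (hc : (c : W) = cs.orderedProd π) :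
      F c = AcyclicOrientation.ofOrder M.coxeterGraph π :=
    cs.ofOrder_eq_of_orderedProd_eq ((horder c).trans hc)
  have hbij : F.Bijective := by
    refine ⟨fun c c' h => Subtype.ext ?_, fun O => ?_⟩
    · rw [← horder c, ← horder c']
      exact cs.orderedProd_eq_of_ofOrder_eq h
    · obtain ⟨π, rfl⟩ := O.exists_ofOrder_eq
      exact ⟨⟨cs.orderedProd π, π, rfl⟩, hF π _ rfl⟩
  let f := Equiv.ofBijective F hbij
  have hconj (c c' : cs.coxeterElements) :
      IsConj (c : W) (c' : W) ↔ AcyclicOrientation.KappaEquiv (f c) (f c') := by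
    rw [← horder c, ← horder c']
    exact ⟨cs.kappaEquiv_of_isConj, cs.isConj_of_kappaEquiv⟩
  refine ⟨f, hF, hconj, ?_⟩
  rw [← Nat.card_coe_set_eq, SimpleGraph.kappa]
  symm
  refine Nat.card_eq_of_bijective (Quot.lift (fun O => ⟨ConjClasses.mk (f.symm O : W),
    Set.mem_image_of_mem _ (f.symm O).2⟩) fun O O' h => ?_) ⟨?_, ?_⟩
  · rw [Subtype.mk.injEq, ConjClasses.mk_eq_mk_iff_isConj, hconj]
    simpa using h
  · rintro ⟨O⟩ ⟨O'⟩ h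
    have h := Subtype.mk.inj h
    rw [ConjClasses.mk_eq_mk_iff_isConj, hconj] at h
    exact Quot.sound (by simpa using h)
  · rintro ⟨_, c, hc, rfl⟩
    exact ⟨Quot.mk _ (f ⟨c, hc⟩), by simp⟩
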